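/- \textbf{Conventions.} A (bivariate) \emph{symbol} is a real Laurent polynomial $a(z_1,z_2)=\sum_{\alpha\in\mathbb Z^2}a_\alpha z_1^{\alpha_1}z_2^{\alpha_2}$; its subdivision operator is $(S_af)_\alpha=\sum_{\beta\in\mathbb Z^2}a_{\alpha-2\beta}f_\beta$. The symbol $a$ is \emph{symmetric} if $a_{(\alpha_1,\alpha_2)}=a_{(-\alpha_1,\alpha_2)}=a_{(\alpha_1,-\alpha_2)}=a_{(\alpha_2,\alpha_1)}$ for all $\alpha$, and \emph{interpolatory} if $a_{2\beta}=1$ for $\beta=0$ and $a_{2\beta}=0$ for $\beta\in\mathbb Z^2\setminus\{0\}$. It satisfies the \emph{generation condition of degree $d$} if $(D^{k}a)(z)=0$ for all $z\in\{(-1,1),(1,-1),(-1,-1)\}$ and all $k\in\mathbb N_0^2$ with $|k|\le d$ (sum rule of order $d+1$), and the \emph{reproduction condition of degree $d$} if $a(1,1)=4$ and $(D^{k}a)(1,1)=0$ for all $k\in\mathbb N_0^2$ with $0<|k|\le d$. For data $f:\mathbb Z^2\to\mathbb R$ and a function $g:\mathbb R^2\to\mathbb R$, we say that the scheme of $a$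 started from $f$ \emph{converges to} $g$ if, for every $R>0$, $\max\{|(S_a^kf)_\alpha-g(2^{-k}\alpha)| : \alpha\in\mathbb Z^2,\ |2^{-k}\alpha_1|,|2^{-k}\alpha_2|\le R\}\to0$ as $k\to\infty$. The \emph{support} of $a$ is the convex hull in $\mathbb R^2$ of $\{\alpha : a_\alpha\ne0\}$, and the \emph{size} of the support is its area. For $0\le l<n$ let \[ u_n^l(z)=2\,\sigma(z)^n\sum_{i=0}^{l}\binom{n+i-1}{i}\delta(z)^i,\qquad \sigma(z)=\frac{(1+z)^2}{4z},\qquad \delta(z)=-\frac{(1-z)^2}{4z}, \] so that $u_n^{n-1}$ is the symbol of the univariate interpolatory $2n$-point (Dubuc--Deslauriers) scheme. \textbf{Proposition.} For every integer $n\ge1$ let \[ \hat a_n(z_1,z_2)=\sum_{i=0}^{n-1}u_{n-i}^{n-i-1}(z_1)\,u_{i+1}^{i}(z_2)-\sum_{i=0}^{n-2}u_{n-i-1}^{n-i-2}(z_1)\,u_{i+1}^{i}(z_2). \] Then: \begin{enumerate} \item $\hat a_n$ is interpolatory and symmetric. \item $\hat a_n$ generates and reproduces polynomials up to degree $2n-1$: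 it satisfies the generation condition and the reproduction condition of degree $2n-1$; every real bivariate polynomial $p$ of total degree at most $2n-1$ is the limit of the scheme of $\hat a_n$ for some initial data; and the scheme started from the samples $(p(\alpha))_{\alpha\in\mathbb Z^2}$ of such a $p$ converges to $p$. \item The support of $\hat a_n$ is the octagon \[ \{x\in\mathbb R^2:\ |x_1|\le 2n-1,\ |x_2|\le 2n-1,\ |x_1|+|x_2|\le 2n\}, \] that is, the square $[-(2n-1),2n-1]^2$ minus the triangular regions with side length $2n-2$ in its corners. \item $\hat a_n$ is minimally supported: its support has the least size among the supports of all symmetric interpolatory symbols that satisfy the generation condition of degree $2n-1$, and also among the supports of all symmetric symbols that satisfy both the generation and the reproduction condition of degree $2n-1$. \end{enumerate} -/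

import Mathlib

open scoped LaurentPolynomial

noncomputable section

namespace PseudoSpline

/-! ### Univariate pseudo-splines -/

/-- `σ(z) = (1 + z)² / (4 z)`. -/
def sigma : ℝ[T;T⁻¹] :=
  LaurentPolynomial.C (1 / 4) * (1 + LaurentPolynomial.T 1) ^ 2 * LaurentPolynomial.T (-1)

/-- `δ(z) = -(1 - z)² / (4 z)`. -/
def delta : ℝ[T;T⁻¹] :=
  -(LaurentPolynomial.C (1 / 4) * (1 - LaurentPolynomial.T 1) ^ 2 * LaurentPolynomial.T (-1))

/-- The univariate pseudo-spline symbol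
`u_n^l(z) = 2 σ(z)^n ∑_{i=0}^{l} binom(n+i-1, i) δ(z)^i`, used for `0 ≤ l < n`. -/
def uSymbol (n l : ℕ) : ℝ[T;T⁻¹] :=
  2 * sigma ^ n * ∑ i ∈ Finset.range (l + 1), ((n + i - 1).choose i : ℝ[T;T⁻¹]) * delta ^ i

/-! ### Bivariate symbols -/

/-- Bivariate symbols: Laurent polynomials in `z₁, z₂` with real coefficients. The mask of the
symbol `a` is its finitely supported coefficient function `a.coeff : ℤ × ℤ →₀ ℝ`. -/
abbrev Symbol : Type := AddMonoidAlgebra ℝ (ℤ × ℤ)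

/-- `u(z) ↦ u(z₁)`. -/
def inFirst : ℝ[T;T⁻¹] →+* Symbol :=
  AddMonoidAlgebra.mapDomainRingHom ℝ (AddMonoidHom.inl ℤ ℤ)

/-- `u(z) ↦ u(z₂)`. -/
def inSecond : ℝ[T;T⁻¹] →+* Symbol :=
  AddMonoidAlgebra.mapDomainRingHom ℝ (AddMonoidHom.inr ℤ ℤ)

/-- The symbols
`â_n(z) = ∑_{i=0}^{n-1} u_{n-i}^{n-i-1}(z₁) u_{i+1}^{i}(z₂)
        - ∑_{i=0}^{n-2} u_{n-i-1}^{n-i-2}(z₁) u_{i+1}^{i}(z₂)`, for `n ≥ 1`. -/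
def hatA (n : ℕ) : Symbol :=
  ∑ i ∈ Finset.range n,
      inFirst (uSymbol (n - i) (n - i - 1)) * inSecond (uSymbol (i + 1) i)
    - ∑ i ∈ Finset.range (n - 1),
      inFirst (uSymbol (n - i - 1) (n - i - 2)) * inSecond (uSymbol (i + 1) i)

/-- The value `a(z₁, z₂)`, for nonzero complex `z₁, z₂`. -/
def evalAt (a : Symbol) (z₁ z₂ : ℂ) : ℂ :=
  ∑ α ∈ a.coeff.support, (a.coeff α : ℂ) * z₁ ^ α.1 * z₂ ^ α.2

/-- The partial derivative `(D^k a)(z₁, z₂)`, `k = (k₁, k₂)`. -/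
def partialDeriv (k : ℕ × ℕ) (a : Symbol) (z₁ z₂ : ℂ) : ℂ :=
  iteratedDeriv k.1 (fun x => iteratedDeriv k.2 (fun y => evalAt a x y) z₂) z₁

/-- Symmetry in the four-directional setting, in terms of the mask. -/
def IsSymmetric (a : Symbol) : Prop :=
  ∀ α₁ α₂ : ℤ, a.coeff (α₁, α₂) = a.coeff (-α₁, α₂) ∧
    a.coeff (α₁, α₂) = a.coeff (α₁, -α₂) ∧ a.coeff (α₁, α₂) = a.coeff (α₂, α₁)

/-- The symbol is interpolatory: `a_{2β}` is `1` for `β = 0` and `0` otherwise. -/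
def IsInterpolatory (a : Symbol) : Prop :=
  ∀ β₁ β₂ : ℤ, a.coeff (2 * β₁, 2 * β₂) = if β₁ = 0 ∧ β₂ = 0 then 1 else 0

/-- Algebraic condition for generation of polynomials up to degree `d` (sum rule of order `d + 1`):
`(D^k a)(z) = 0` for `z ∈ {(-1,1), (1,-1), (-1,-1)}` and `0 ≤ |k| ≤ d`. -/
def Generates (a : Symbol) (d : ℕ) : Prop :=
  ∀ k : ℕ × ℕ, k.1 + k.2 ≤ d →
    partialDeriv k a (-1) 1 = 0 ∧ partialDeriv k a 1 (-1) = 0 ∧ partialDeriv k a (-1) (-1) = 0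

/-- Algebraic condition for reproduction of polynomials up to degree `d`, for a primal scheme that
generates polynomials up to that degree: `a(1,1) = 4` and `(D^k a)(1,1) = 0` for `0 < |k| ≤ d`. -/
def Reproduces (a : Symbol) (d : ℕ) : Prop :=
  evalAt a 1 1 = 4 ∧ ∀ k : ℕ × ℕ, 0 < k.1 + k.2 → k.1 + k.2 ≤ d → partialDeriv k a 1 1 = 0

/-! ### The subdivision scheme -/

/-- The subdivision operator `(S_a f)_α = ∑_β a_{α - 2β} f_β`. -/
def subdiv (a : Symbol) (f : ℤ × ℤ → ℝ) : ℤ × ℤ → ℝ :=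
  fun α => ∑ᶠ β : ℤ × ℤ, a.coeff (α.1 - 2 * β.1, α.2 - 2 * β.2) * f β

/-- The primal subdivision scheme with symbol `a`, started from the data `f`, converges to the
function `g`, uniformly on bounded sets: the data of level `k` are attached to the grid
`2^{-k} ℤ²`. -/
def ConvergesTo (a : Symbol) (f : ℤ × ℤ → ℝ) (g : ℝ → ℝ → ℝ) : Prop :=
  ∀ R : ℝ, ∀ ε > 0, ∃ k₀ : ℕ, ∀ k ≥ k₀, ∀ α : ℤ × ℤ,
    |(α.1 : ℝ) / 2 ^ k| ≤ R → |(α.2 : ℝ) / 2 ^ k| ≤ R →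
      |(subdiv a)^[k] f α - g ((α.1 : ℝ) / 2 ^ k) ((α.2 : ℝ) / 2 ^ k)| < ε

/-- Every bivariate polynomial of total degree at most `d` is the limit of the scheme for some
initial data. -/
def GeneratesInLimit (a : Symbol) (d : ℕ) : Prop :=
  ∀ p : MvPolynomial (Fin 2) ℝ, p.totalDegree ≤ d →
    ∃ f : ℤ × ℤ → ℝ, ConvergesTo a f (fun x y => MvPolynomial.eval ![x, y] p)

/-- For every bivariate polynomial of total degree at most `d`, the scheme started from its samples
on `ℤ²` converges to that polynomial. -/
def ReproducesInLimit (a : Symbol) (d : ℕ) : Prop :=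
  ∀ p : MvPolynomial (Fin 2) ℝ, p.totalDegree ≤ d →
    ConvergesTo a (fun α => MvPolynomial.eval ![(α.1 : ℝ), (α.2 : ℝ)] p)
      (fun x y => MvPolynomial.eval ![x, y] p)

/-! ### Supports -/

/-- The support of a symbol: the convex hull of `{α : a_α ≠ 0}`. -/
def supp (a : Symbol) : Set (ℝ × ℝ) :=
  convexHull ℝ ((fun α : ℤ × ℤ => ((α.1 : ℝ), (α.2 : ℝ))) '' {α | a.coeff α ≠ 0})

/-- The size of the support: the area of the convex hull. -/
def suppSize (a : Symbol) : ENNReal := MeasureTheory.volume (supp a)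

/-- The rectangle `[-m, m] × [-n, n]` minus the triangular regions with side length `l` in each
corner. -/
def octagon (m n l : ℝ) : Set (ℝ × ℝ) :=
  {x | |x.1| ≤ m ∧ |x.2| ≤ n ∧ |x.1| + |x.2| ≤ m + n - l}

end PseudoSpline

end

noncomputable section

namespace PseudoSpline

open Polynomial (X)

/-! ### Pairing masks with weights -/

/-! Every condition on a symbol becomes a statement about sums `∑ a_α w(α)`, with `w` a polynomial
times a sign character `s^α₁ t^α₂`, `s, t = ±1`; see `partialDeriv_eq`.

In one variable, `dd m` is divisible by `(1+z)^(2m)` and, by the Bezout identity, `2 - dd m` by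
`(1-z)^(2m)`. Hence its moments of degree below `2m` are exact (`pairing_dd`). Written as `∑ (dd
(n-i) - dd (n-i-1))(z₁) · dd (i+1)(z₂)`, the bivariate symbol telescopes. Against `q(α₁) r(α₂)` with
`deg q + deg r ≤ 2n-1`, each term has either an exact second factor or a vanishing first one, so the
sum collapses to the exact moments of `dd n` (`hasMoments_hatA`). Generation, reproduction and both
limit statements follow.

For minimality, the sum rules give all cosets of `2ℤ²` equal moments in `α₁`. Testing the odd-odd
coset with a polynomial that vanishes at the small odd integers forces a nonzero coefficient with
`|α₁| ≥ 2n-1` and `|α₂| ≥ 1` (`Generates.exists_coeff_ne_zero`). Symmetry and convexity then put the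
whole octagon in the support. For `hatA n` itself this is the nontrivial half of the support
formula. -/

/-- The pairing `∑_γ a_γ w(γ)` of a weight function `w` with a mask `a`. -/
def pairing {G : Type*} : (G → ℝ) →ₗ[ℝ] AddMonoidAlgebra ℝ G →ₗ[ℝ] ℝ :=
  LinearMap.mk₂ ℝ (fun w a => a.coeff.sum fun g c => c * w g)
    (fun w₁ w₂ a => by simp [Finsupp.sum, mul_add, Finset.sum_add_distrib])
    (fun c w a => by simp [Finsupp.sum, Finset.mul_sum, mul_left_comm])
    (fun w a b => by
      rw [AddMonoidAlgebra.coeff_add]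
      exact Finsupp.sum_add_index' (fun _ => zero_mul _) (fun _ _ _ => add_mul _ _ _))
    (fun c w a => by
      rw [AddMonoidAlgebra.coeff_smul, Finsupp.sum_smul_index (fun _ => zero_mul _)]
      simp [Finsupp.sum, Finset.mul_sum, mul_assoc])

lemma pairing_apply {G : Type*} (w : G → ℝ) (a : AddMonoidAlgebra ℝ G) :
    pairing w a = ∑ g ∈ a.coeff.support, a.coeff g * w g := rfl

lemma pairing_single {G : Type*} (w : G → ℝ) (g : G) (c : ℝ) :
    pairing w (AddMonoidAlgebra.single g c) = c * w g := by
  change (AddMonoidAlgebra.single g c).coeff.sum (fun g c => c * w g) = _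
  rw [AddMonoidAlgebra.coeff_single, Finsupp.sum_single_index (zero_mul _)]

lemma pairing_zero_left {G : Type*} (a : AddMonoidAlgebra ℝ G) :
    pairing (fun _ => 0) a = 0 := by
  simp [pairing_apply]

lemma pairing_ext {G : Type*} {w w' : G → ℝ} {a : AddMonoidAlgebra ℝ G}
    (h : ∀ g, a.coeff g ≠ 0 → w g = w' g) : pairing w a = pairing w' a := by
  rw [pairing_apply, pairing_apply]
  exact Finset.sum_congr rfl fun g hg => by rw [h g (Finsupp.mem_support_iff.1 hg)]

lemma pairing_mul_T (w : ℤ → ℝ) (f : ℝ[T;T⁻¹]) (m : ℤ) :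
    pairing w (f * LaurentPolynomial.T m) = pairing (fun γ => w (γ + m)) f := by
  induction f using AddMonoidAlgebra.induction_linear with
  | zero => simp
  | add f g hf hg => rw [add_mul, map_add, map_add, hf, hg]
  | single g c =>
    rw [LaurentPolynomial.T, AddMonoidAlgebra.single_mul_single, pairing_single, pairing_single,
      mul_one]

lemma degree_sub_taylor_lt {q : Polynomial ℝ} (hq : q ≠ 0) :
    (q - Polynomial.taylor 1 q).degree < q.degree :=
  Polynomial.degree_sub_lt_left (Polynomial.degree_taylor q 1).symm hq
    (Polynomial.leadingCoeff_taylor 1 q).symm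

/-- Multiplying the symbol by `1 - s z` replaces the weight `s^γ q(γ)` by `s^γ (q(γ) - q(γ+1))`,
because `s² = 1`. Each factor thus lowers the degree of `q`, and `m` of them annihilate degree below
`m`. -/
lemma pairing_one_sub_pow_mul {s : ℝ} (hs : s = 1 ∨ s = -1) (m : ℕ) (q : Polynomial ℝ)
    (hq : q.degree < m) (f : ℝ[T;T⁻¹]) :
    pairing (fun γ : ℤ => s ^ γ * q.eval (γ : ℝ))
      ((1 - LaurentPolynomial.C s * LaurentPolynomial.T 1) ^ m * f) = 0 := by
  have hs0 : s ≠ 0 := by rcases hs with rfl | rfl <;> norm_num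
  have hss : s * s = 1 := by rcases hs with rfl | rfl <;> norm_num
  induction m generalizing q with
  | zero =>
    have : q = 0 := by
      rw [← Polynomial.degree_eq_bot]
      simpa [Nat.WithBot.lt_zero_iff] using hq
    simp only [this, Polynomial.eval_zero, mul_zero, pairing_zero_left]
  | succ m ih =>
    rcases eq_or_ne q 0 with rfl | h0
    · simp only [Polynomial.eval_zero, mul_zero, pairing_zero_left]
    set g := (1 - LaurentPolynomial.C s * LaurentPolynomial.T 1) ^ m * f with hg
    have e : (1 - LaurentPolynomial.C s * LaurentPolynomial.T 1) ^ (m + 1) * f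
        = g - s • (g * LaurentPolynomial.T 1) := by
      rw [LaurentPolynomial.smul_eq_C_mul, hg]; ring
    have hd : (q - Polynomial.taylor 1 q).degree < m := by
      have h1 := degree_sub_taylor_lt h0
      rcases eq_or_ne (q - Polynomial.taylor 1 q) 0 with h2 | h2
      · rw [h2, Polynomial.degree_zero]; exact WithBot.bot_lt_coe _
      · rw [Polynomial.degree_eq_natDegree h0] at h1 hq
        rw [Polynomial.degree_eq_natDegree h2] at h1 ⊢
        norm_cast at *
        omega
    rw [e, map_sub, map_smul, pairing_mul_T, ← ih _ hd, ← LinearMap.smul_apply,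
      ← LinearMap.sub_apply, ← map_smul, ← map_sub]
    congr 2
    funext γ
    simp only [Pi.sub_apply, Pi.smul_apply, smul_eq_mul, Polynomial.eval_sub,
      Polynomial.taylor_eval, zpow_add_one₀ hs0]
    push_cast
    linear_combination (-(s ^ γ * Polynomial.eval ((γ : ℝ) + 1) q)) * hss

/-! ### The Dubuc-Deslauriers symbols -/

/-- The truncated binomial series `∑_{i<n} binom(n+i-1, i) yⁱ`. -/
def truncSeries {R : Type*} [CommRing R] (n : ℕ) (y : R) : R :=
  ∑ i ∈ Finset.range n, ((n + i - 1).choose i : R) * y ^ i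

/-- `truncSeries n y` truncates the series of `(1-y)^(-n)`, so multiplication by `x = 1 - y` lowers
the exponent by one (Pascal's rule). The two extra terms come from the differing truncation orders.
-/
lemma mul_truncSeries_succ {R : Type*} [CommRing R] {x y : R} (h : x + y = 1) (n : ℕ) :
    x * truncSeries (n + 2) y = truncSeries (n + 1) y
      + ((2 * n + 1).choose (n + 1) : R) * y ^ (n + 1)
      - ((2 * n + 2).choose (n + 1) : R) * y ^ (n + 2) := by
  have key : ∀ k, x * ∑ i ∈ Finset.range (k + 1), ((n + 1 + i).choose i : R) * y ^ i
      = ∑ i ∈ Finset.range (k + 1), ((n + i).choose i : R) * y ^ i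
        - ((n + 1 + k).choose k : R) * y ^ (k + 1) := by
    intro k
    induction k with
    | zero => simp; linear_combination h
    | succ k ih =>
      rw [Finset.sum_range_succ, mul_add, ih, Finset.sum_range_succ _ (k + 1)]
      have : (n + 1 + (k + 1)).choose (k + 1)
          = (n + 1 + k).choose k + (n + (k + 1)).choose (k + 1) := by
        rw [show n + 1 + (k + 1) = (n + 1 + k) + 1 by ring, Nat.choose_succ_succ,
          show n + 1 + k = n + (k + 1) by ring]
      rw [this]
      push_cast
      linear_combination (((n + 1 + k).choose k : R) + ((n + (k + 1)).choose (k + 1) : R))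
        * y ^ (k + 1) * h
  have e1 : truncSeries (n + 2) y
      = ∑ i ∈ Finset.range (n + 2), ((n + 1 + i).choose i : R) * y ^ i :=
    Finset.sum_congr rfl fun i _ => by rw [show n + 2 + i - 1 = n + 1 + i by omega]
  have e2 : truncSeries (n + 1) y
      = ∑ i ∈ Finset.range (n + 1), ((n + i).choose i : R) * y ^ i :=
    Finset.sum_congr rfl fun i _ => by rw [show n + 1 + i - 1 = n + i by omega]
  rw [e1, e2, key, Finset.sum_range_succ, show n + (n + 1) = 2 * n + 1 by ring,
    show n + 1 + (n + 1) = 2 * n + 2 by ring]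

/-- The Bezout identity behind the Dubuc-Deslauriers schemes. -/
lemma truncSeries_bezout {R : Type*} [CommRing R] {x y : R} (h : x + y = 1) (n : ℕ) :
    x ^ (n + 1) * truncSeries (n + 1) y + y ^ (n + 1) * truncSeries (n + 1) x = 1 := by
  induction n with
  | zero => simpa [truncSeries] using h
  | succ n ih =>
    have h1 := mul_truncSeries_succ h n
    have h2 := mul_truncSeries_succ (show y + x = 1 by rw [add_comm]; exact h) n
    have h3 : ((2 * n + 2).choose (n + 1) : R) = 2 * ((2 * n + 1).choose (n + 1) : R) := by
      -- With `C = binom(2n+1, n+1)`, the boundary terms become `C x^(n+1) y^(n+1) ((1 - 2y) + (1 -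
      -- 2x))`, which vanishes as `x + y = 1`.
      have : (2 * n + 2).choose (n + 1) = 2 * (2 * n + 1).choose (n + 1) := by
        rw [Nat.choose_succ_succ, ← Nat.choose_symm_half]; ring
      rw [this]; push_cast; rfl
    rw [h3] at h1 h2
    linear_combination x ^ (n + 1) * h1 + y ^ (n + 1) * h2 + ih
      - 2 * ((2 * n + 1).choose (n + 1) : R) * x ^ (n + 1) * y ^ (n + 1) * h

open LaurentPolynomial in
lemma sigma_add_delta : sigma + delta = 1 := by
  have h1 : (T 1 * T (-1) : ℝ[T;T⁻¹]) = 1 := by rw [← T_add]; simp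
  have h2 : (C (1 / 4) * 4 : ℝ[T;T⁻¹]) = 1 := by
    rw [show (4 : ℝ[T;T⁻¹]) = C 4 from (map_ofNat C 4).symm, ← map_mul]; norm_num
  rw [sigma, delta]
  linear_combination C (1 / 4) * 4 * h1 + h2

open LaurentPolynomial in
lemma sigma_eq : sigma = C (1 / 4) * T 1 + C (1 / 2) + C (1 / 4) * T (-1) := by
  have h1 : (T 1 * T (-1) : ℝ[T;T⁻¹]) = 1 := by rw [← T_add]; simp
  have h2 : (C (1 / 2) : ℝ[T;T⁻¹]) = C (1 / 4) * 2 := by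
    rw [show (2 : ℝ[T;T⁻¹]) = C 2 from (map_ofNat C 2).symm, ← map_mul]; norm_num
  rw [sigma, h2]
  linear_combination C (1 / 4) * (T 1 + 2) * h1

lemma delta_eq : delta = 1 - sigma := by rw [← sigma_add_delta]; ring

/-- The symbol `u_m^{m-1}` of the interpolatory `2m`-point scheme, and `0` for `m = 0`. -/
def dd : ℕ → ℝ[T;T⁻¹]
  | 0 => 0
  | m + 1 => uSymbol (m + 1) m

lemma dd_succ (m : ℕ) :
    dd (m + 1) = 2 * sigma ^ (m + 1) * truncSeries (m + 1) delta := rfl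

lemma two_sub_dd_succ (m : ℕ) :
    2 - dd (m + 1) = 2 * delta ^ (m + 1) * truncSeries (m + 1) sigma := by
  rw [dd_succ]
  linear_combination -2 * truncSeries_bezout sigma_add_delta m

-- For `s = -1` the factor `(1+z)^(2m)` of `dd m` kills the weight. For `s = 1` the factor
-- `(1-z)^(2m)` of `2 - dd m` does, leaving the moment of the constant `2`.
open LaurentPolynomial in
lemma pairing_dd {s : ℝ} (hs : s = 1 ∨ s = -1) {m : ℕ} {q : Polynomial ℝ}
    (hq : q.natDegree < 2 * m) :
    pairing (fun γ : ℤ => s ^ γ * q.eval (γ : ℝ)) (dd m) = (1 + s) * q.eval 0 := by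
  obtain _ | m := m
  · omega
  have hq' : q.degree < (2 * (m + 1) : ℕ) :=
    Polynomial.degree_le_natDegree.trans_lt (by exact_mod_cast hq)
  rcases hs with rfl | rfl
  · have h0 : pairing (fun γ : ℤ => (1 : ℝ) ^ γ * q.eval (γ : ℝ)) (2 - dd (m + 1)) = 0 := by
      rw [← pairing_one_sub_pow_mul (Or.inl rfl) _ q hq'
        (2 * (-1) ^ (m + 1) * C (1 / 4) ^ (m + 1) * T (-1) ^ (m + 1)
          * truncSeries (m + 1) sigma), two_sub_dd_succ, delta, map_one C]
      congr 1
      rw [neg_pow, mul_pow, mul_pow, ← pow_mul]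
      ring
    have h2 : (2 : ℝ[T;T⁻¹]) = AddMonoidAlgebra.single 0 2 := (map_ofNat C 2).symm
    rw [map_sub, h2, pairing_single] at h0
    norm_num at h0 ⊢
    linarith
  · rw [← sub_eq_zero, ← pairing_one_sub_pow_mul (Or.inr rfl) _ q hq'
        (2 * C (1 / 4) ^ (m + 1) * T (-1) ^ (m + 1) * truncSeries (m + 1) delta), dd_succ, sigma]
    rw [add_neg_cancel, zero_mul, sub_zero]
    congr 1
    rw [mul_pow, mul_pow, ← pow_mul, map_neg, map_one]
    ring

lemma invert_dd (m : ℕ) : LaurentPolynomial.invert (dd m) = dd m := by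
  have hσ : LaurentPolynomial.invert sigma = sigma := by
    rw [sigma_eq]; simp; ring
  have hδ : LaurentPolynomial.invert delta = delta := by rw [delta_eq]; simp [hσ]
  cases m with
  | zero => simp [dd]
  | succ m =>
    have h2 : LaurentPolynomial.invert (2 : ℝ[T;T⁻¹]) = 2 := map_ofNat _ 2
    simp [dd_succ, truncSeries, hσ, hδ, h2]

lemma dd_coeff_neg (m : ℕ) (γ : ℤ) : (dd m).coeff (-γ) = (dd m).coeff γ := by
  rw [← LaurentPolynomial.invert_apply, invert_dd]

/-! ### Support bounds and even coefficients in one variable. -/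

/-- The Laurent polynomials with exponents in `[-m, m]`. -/
def boundedBy (m : ℕ) : Submodule ℝ ℝ[T;T⁻¹] where
  carrier := {f | ∀ γ : ℤ, f.coeff γ ≠ 0 → |γ| ≤ m}
  zero_mem' := by simp
  add_mem' {f g} hf hg γ h := by
    by_contra hc
    exact h (by simp [not_not.1 (mt (hf γ) hc), not_not.1 (mt (hg γ) hc)])
  smul_mem' c f hf γ h := hf γ fun h0 => h (by simp [h0])

lemma boundedBy_mono {m n : ℕ} (h : m ≤ n) : boundedBy m ≤ boundedBy n :=
  fun _ hf γ hγ => (hf γ hγ).trans (by exact_mod_cast h)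

lemma mul_mem_boundedBy {m n : ℕ} {f g : ℝ[T;T⁻¹]} (hf : f ∈ boundedBy m)
    (hg : g ∈ boundedBy n) : f * g ∈ boundedBy (m + n) := by
  classical
  intro γ hγ
  obtain ⟨i, hi, j, hj, rfl⟩ := Finset.mem_add.1
    (AddMonoidAlgebra.support_coeff_mul_subset f g (Finsupp.mem_support_iff.2 hγ))
  have h1 := hf i (Finsupp.mem_support_iff.1 hi)
  have h2 := hg j (Finsupp.mem_support_iff.1 hj)
  have := abs_add_le i j
  push_cast
  linarith

lemma single_mem_boundedBy {m : ℕ} {k : ℤ} (hk : |k| ≤ m) (c : ℝ) :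
    (AddMonoidAlgebra.single k c : ℝ[T;T⁻¹]) ∈ boundedBy m := by
  intro γ hγ
  rw [AddMonoidAlgebra.coeff_single, Finsupp.single_apply] at hγ
  split_ifs at hγ with h
  · exact h ▸ hk
  · exact absurd rfl hγ

lemma natCast_mem_boundedBy (k : ℕ) : (k : ℝ[T;T⁻¹]) ∈ boundedBy 0 := by
  rw [← map_natCast LaurentPolynomial.C]
  exact single_mem_boundedBy (by simp) _

lemma pow_mem_boundedBy {m : ℕ} {f : ℝ[T;T⁻¹]} (hf : f ∈ boundedBy m) (k : ℕ) :
    f ^ k ∈ boundedBy (k * m) := by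
  induction k with
  | zero => simpa using natCast_mem_boundedBy 1
  | succ k ih => rw [pow_succ, add_mul, one_mul]; exact mul_mem_boundedBy ih hf

lemma sigma_mem_boundedBy : sigma ∈ boundedBy 1 := by
  rw [sigma_eq, ← LaurentPolynomial.single_eq_C_mul_T, ← LaurentPolynomial.single_eq_C_mul_T]
  exact add_mem (add_mem (single_mem_boundedBy (by simp) _) (single_mem_boundedBy (by simp) _))
    (single_mem_boundedBy (by simp) _)

lemma delta_mem_boundedBy : delta ∈ boundedBy 1 := by
  rw [delta_eq]
  refine sub_mem (boundedBy_mono zero_le_one ?_) sigma_mem_boundedBy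
  simpa using natCast_mem_boundedBy 1

lemma dd_mem_boundedBy (m : ℕ) : dd m ∈ boundedBy (2 * m - 1) := by
  cases m with
  | zero => exact zero_mem _
  | succ m =>
    rw [dd_succ, truncSeries, Finset.mul_sum]
    refine sum_mem fun i hi => ?_
    have hi' := Finset.mem_range.1 hi
    have h2 : (2 : ℝ[T;T⁻¹]) ∈ boundedBy 0 := by exact_mod_cast natCast_mem_boundedBy 2
    exact boundedBy_mono (by omega)
      (mul_mem_boundedBy (mul_mem_boundedBy h2 (pow_mem_boundedBy sigma_mem_boundedBy (m + 1)))
        (mul_mem_boundedBy (natCast_mem_boundedBy _) (pow_mem_boundedBy delta_mem_boundedBy i)))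

/-- The coset moments: for `q` of degree less than `2m`, the sum of `(dd m)_γ q(γ)` over the even
`γ` is `q(0)`. -/
lemma pairing_dd_even {m : ℕ} {q : Polynomial ℝ} (hq : q.natDegree < 2 * m) :
    pairing (fun γ : ℤ => if Even γ then q.eval (γ : ℝ) else 0) (dd m) = q.eval 0 := by
  have e : (fun γ : ℤ => if Even γ then q.eval (γ : ℝ) else 0)
      = (1 / 2 : ℝ) • ((fun γ : ℤ => (1 : ℝ) ^ γ * q.eval (γ : ℝ))
        + fun γ : ℤ => (-1 : ℝ) ^ γ * q.eval (γ : ℝ)) := by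
    funext γ
    rcases Int.even_or_odd γ with h | h
    · simp [h, h.neg_one_zpow]; ring
    · simp [Int.not_even_iff_odd.2 h, h.neg_one_zpow]
  rw [e, map_smul, map_add, LinearMap.smul_apply, LinearMap.add_apply, pairing_dd (Or.inl rfl) hq,
    pairing_dd (Or.inr rfl) hq, smul_eq_mul]
  ring

/-- The even exponents in `[-(2m-1), 2m-1]` number only `2m - 1`, so a Lagrange polynomial of degree
`2m - 2` isolates each even coefficient within the range of `pairing_dd_even`. -/
lemma dd_coeff_two_mul {m : ℕ} (hm : m ≠ 0) (β : ℤ) :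
    (dd m).coeff (2 * β) = if β = 0 then 1 else 0 := by
  by_cases hβ : |2 * β| ≤ ((2 * m - 1 : ℕ) : ℤ)
  swap
  · have h0 : (dd m).coeff (2 * β) = 0 := not_not.1 (mt (dd_mem_boundedBy m _) hβ)
    rw [h0, if_neg]
    rintro rfl
    simp at hβ
  set S := (Finset.Icc (-((m : ℤ) - 1)) (m - 1)).erase β with hS
  have hβS : β ∈ Finset.Icc (-((m : ℤ) - 1)) (m - 1) := by
    rw [Finset.mem_Icc]
    rw [abs_le] at hβ
    omega
  set q : Polynomial ℝ := ∏ j ∈ S, (X - Polynomial.C (2 * (j : ℝ))) with hq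
  have hdeg : q.natDegree < 2 * m := by
    rw [hq, Polynomial.natDegree_finsetProd_X_sub_C_eq_card, hS, Finset.card_erase_of_mem hβS,
      Int.card_Icc]
    omega
  have heval : ∀ j : ℤ, q.eval (2 * (j : ℝ)) = 0 ↔ j ∈ S := by
    intro j
    rw [hq, Polynomial.eval_prod, Finset.prod_eq_zero_iff]
    simp only [Polynomial.eval_sub, Polynomial.eval_X, Polynomial.eval_C, sub_eq_zero]
    constructor
    · rintro ⟨a, ha, h⟩
      have : j = a := by exact_mod_cast mul_left_cancel₀ two_ne_zero h
      exact this ▸ ha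
    · exact fun h => ⟨j, h, rfl⟩
  have hβ0 : q.eval (2 * (β : ℝ)) ≠ 0 := fun h => by
    simpa [hS] using (heval β).1 h
  have hmom := pairing_dd_even hdeg
  have hsum : pairing (fun γ : ℤ => if Even γ then q.eval (γ : ℝ) else 0) (dd m)
      = (dd m).coeff (2 * β) * q.eval (2 * (β : ℝ)) := by
    rw [pairing_apply, Finset.sum_eq_single (2 * β)]
    · simp
    · intro γ hγ hne
      split_ifs with he
      · obtain ⟨j, rfl⟩ := he.two_dvd
        have hb := dd_mem_boundedBy m _ (Finsupp.mem_support_iff.1 hγ)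
        have : j ∈ S := by
          rw [hS, Finset.mem_erase, Finset.mem_Icc]
          rw [abs_le] at hb
          refine ⟨fun h => hne (h ▸ rfl), ?_, ?_⟩ <;> omega
        rw [Int.cast_mul, Int.cast_ofNat, (heval j).2 this, mul_zero]
      · rw [mul_zero]
    · intro h
      rw [Finsupp.notMem_support_iff.1 h, zero_mul]
  rw [hsum] at hmom
  split_ifs with h
  · subst h
    rw [Int.cast_zero, mul_zero (2 : ℝ)] at hmom hβ0
    exact mul_right_cancel₀ hβ0 (by rw [hmom, one_mul])
  · have h0 : q.eval 0 = 0 := by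
      have : (0 : ℤ) ∈ S := by
        rw [hS, Finset.mem_erase, Finset.mem_Icc]
        refine ⟨fun h' => h h'.symm, ?_, ?_⟩ <;> omega
      simpa using (heval 0).2 this
    rw [h0] at hmom
    exact (mul_eq_zero.1 hmom).resolve_right hβ0

/-! ### Tensor products of univariate symbols -/

lemma inFirst_single (i : ℤ) (c : ℝ) :
    inFirst (AddMonoidAlgebra.single i c) = AddMonoidAlgebra.single (i, 0) c :=
  AddMonoidAlgebra.mapDomain_single

lemma inSecond_single (i : ℤ) (c : ℝ) :
    inSecond (AddMonoidAlgebra.single i c) = AddMonoidAlgebra.single (0, i) c :=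
  AddMonoidAlgebra.mapDomain_single

lemma pairing_inFirst_mul_inSecond (w₁ w₂ : ℤ → ℝ) (f g : ℝ[T;T⁻¹]) :
    pairing (fun α : ℤ × ℤ => w₁ α.1 * w₂ α.2) (inFirst f * inSecond g)
      = pairing w₁ f * pairing w₂ g := by
  induction f using AddMonoidAlgebra.induction_linear with
  | zero => simp
  | add f f' hf hf' => rw [map_add, add_mul, map_add, hf, hf', map_add, add_mul]
  | single i c =>
    induction g using AddMonoidAlgebra.induction_linear with
    | zero => simp
    | add g g' hg hg' => rw [map_add, mul_add, map_add, hg, hg', map_add, mul_add]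
    | single j d =>
      rw [inFirst_single, inSecond_single, AddMonoidAlgebra.single_mul_single, pairing_single,
        pairing_single, pairing_single]
      simp only [Prod.mk_add_mk, add_zero, zero_add]
      ring

lemma pairing_indicator {G : Type*} [DecidableEq G] (a : AddMonoidAlgebra ℝ G) (g : G) :
    pairing (fun x => if x = g then 1 else 0) a = a.coeff g := by
  rw [pairing_apply, Finset.sum_eq_single g]
  · simp
  · intro b _ hb
    simp [hb]
  · intro h
    simp [Finsupp.notMem_support_iff.1 h]

lemma coeff_inFirst_mul_inSecond (f g : ℝ[T;T⁻¹]) (α : ℤ × ℤ) :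
    (inFirst f * inSecond g).coeff α = f.coeff α.1 * g.coeff α.2 := by
  rw [← pairing_indicator, ← pairing_indicator f, ← pairing_indicator g,
    ← pairing_inFirst_mul_inSecond]
  refine pairing_ext fun x _ => ?_
  by_cases h1 : x.1 = α.1 <;> by_cases h2 : x.2 = α.2 <;> simp [Prod.ext_iff, h1, h2]

/-! ### The symbols `hatA n` -/

lemma hatA_succ (n : ℕ) :
    hatA (n + 1) = ∑ i ∈ Finset.range (n + 1), inFirst (dd (n + 1 - i)) * inSecond (dd (i + 1))
      - ∑ i ∈ Finset.range n, inFirst (dd (n - i)) * inSecond (dd (i + 1)) := by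
  rw [hatA, Nat.add_sub_cancel]
  congr 1 <;> refine Finset.sum_congr rfl fun i hi => ?_ <;> have := Finset.mem_range.1 hi
  · obtain ⟨k, hk⟩ : ∃ k, n + 1 - i = k + 1 := ⟨n - i, by omega⟩
    rw [hk]
    rfl
  · obtain ⟨k, hk⟩ : ∃ k, n - i = k + 1 := ⟨n - i - 1, by omega⟩
    rw [show n + 1 - i - 1 = k + 1 by omega, show n + 1 - i - 2 = k by omega, hk]
    rfl

/-- The convention `dd 0 = 0` supplies the missing last term of the subtracted sum, so the two sums
merge into telescoping differences. -/
lemma hatA_succ' (n : ℕ) :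
    hatA (n + 1) = ∑ i ∈ Finset.range (n + 1),
      inFirst (dd (n + 1 - i) - dd (n - i)) * inSecond (dd (i + 1)) := by
  have h : ∑ i ∈ Finset.range n, inFirst (dd (n - i)) * inSecond (dd (i + 1))
      = ∑ i ∈ Finset.range (n + 1), inFirst (dd (n - i)) * inSecond (dd (i + 1)) := by
    rw [Finset.sum_range_succ, Nat.sub_self, dd, map_zero, zero_mul, add_zero]
  rw [hatA_succ, h, ← Finset.sum_sub_distrib]
  simp only [map_sub, sub_mul]

lemma sum_range_reflect_sub (F : ℕ → ℝ) (n : ℕ) :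
    ∑ i ∈ Finset.range (n + 1), (F (n + 1 - i) - F (n - i)) = F (n + 1) - F 0 := by
  have := Finset.sum_range_sub' (fun i => F (n + 1 - i)) (n + 1)
  simpa only [Nat.add_sub_add_right, Nat.sub_zero, Nat.sub_self] using this

lemma hatA_coeff (n : ℕ) (α : ℤ × ℤ) :
    (hatA (n + 1)).coeff α = ∑ i ∈ Finset.range (n + 1),
      ((dd (n + 1 - i)).coeff α.1 - (dd (n - i)).coeff α.1) * (dd (i + 1)).coeff α.2 := by
  rw [hatA_succ', AddMonoidAlgebra.coeff_sum, Finsupp.finsetSum_apply]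
  simp only [coeff_inFirst_mul_inSecond, AddMonoidAlgebra.coeff_sub, Finsupp.sub_apply]

lemma isInterpolatory_hatA (n : ℕ) : IsInterpolatory (hatA (n + 1)) := by
  intro β₁ β₂
  simp only [hatA_coeff, dd_coeff_two_mul (Nat.succ_ne_zero _)]
  rw [← Finset.sum_mul, sum_range_reflect_sub (fun m => (dd m).coeff (2 * β₁)),
    dd_coeff_two_mul (Nat.succ_ne_zero _), dd]
  by_cases h1 : β₁ = 0 <;> by_cases h2 : β₂ = 0 <;> simp [h1, h2]

lemma isSymmetric_hatA (n : ℕ) : IsSymmetric (hatA (n + 1)) := by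
  intro α₁ α₂
  refine ⟨by simp only [hatA_coeff, dd_coeff_neg], by simp only [hatA_coeff, dd_coeff_neg], ?_⟩
  -- The swap of variables is visible in the two-sum form: reversing the order of summation
  -- exchanges the factors in each sum.
  simp only [hatA_succ, AddMonoidAlgebra.coeff_sub, AddMonoidAlgebra.coeff_sum,
    Finsupp.sub_apply, Finsupp.finsetSum_apply, coeff_inFirst_mul_inSecond]
  congr 1
  · rw [← Finset.sum_range_reflect]
    refine Finset.sum_congr rfl fun i hi => ?_
    have := Finset.mem_range.1 hi
    rw [show n + 1 - (n + 1 - 1 - i) = i + 1 by omega,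
      show n + 1 - 1 - i + 1 = n + 1 - i by omega, mul_comm]
  · rw [← Finset.sum_range_reflect]
    refine Finset.sum_congr rfl fun i hi => ?_
    have := Finset.mem_range.1 hi
    rw [show n - (n - 1 - i) = i + 1 by omega, show n - 1 - i + 1 = n - i by omega, mul_comm]

lemma hatA_coeff_ne_zero {n : ℕ} {α : ℤ × ℤ} (h : (hatA (n + 1)).coeff α ≠ 0) :
    |α.1| ≤ 2 * n + 1 ∧ |α.2| ≤ 2 * n + 1 ∧ |α.1| + |α.2| ≤ 2 * n + 2 := by
  rw [hatA_coeff] at h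
  obtain ⟨i, hi, hne⟩ := Finset.exists_ne_zero_of_sum_ne_zero h
  have hi' := Finset.mem_range.1 hi
  have h1 : |α.1| ≤ ((2 * (n + 1 - i) - 1 : ℕ) : ℤ) :=
    sub_mem (dd_mem_boundedBy (n + 1 - i))
      (boundedBy_mono (by omega) (dd_mem_boundedBy (n - i))) _ (left_ne_zero_of_mul hne)
  have h2 : |α.2| ≤ ((2 * (i + 1) - 1 : ℕ) : ℤ) :=
    dd_mem_boundedBy (i + 1) _ (right_ne_zero_of_mul hne)
  omega

/-! ### Moments -/

/-- The moments of `a` on all cosets of `2ℤ²`, up to degree `d`, are those of the symbol of an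
exact scheme; the cosets are encoded by the characters `α ↦ s^α₁ t^α₂` with `s, t ∈ {1, -1}`. -/
def HasMoments (a : Symbol) (d : ℕ) : Prop :=
  ∀ s t : ℝ, (s = 1 ∨ s = -1) → (t = 1 ∨ t = -1) → ∀ q r : Polynomial ℝ,
    q.natDegree + r.natDegree ≤ d →
      pairing (fun α : ℤ × ℤ => (s ^ α.1 * q.eval (α.1 : ℝ)) * (t ^ α.2 * r.eval (α.2 : ℝ))) a
        = (1 + s) * (1 + t) * (q.eval 0 * r.eval 0)

lemma hasMoments_hatA (n : ℕ) : HasMoments (hatA (n + 1)) (2 * n + 1) := by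
  intro s t hs ht q r hqr
  rw [hatA_succ', map_sum]
  have hterm : ∀ i ∈ Finset.range (n + 1),
      pairing (fun α : ℤ × ℤ => (s ^ α.1 * q.eval (α.1 : ℝ)) * (t ^ α.2 * r.eval (α.2 : ℝ)))
        (inFirst (dd (n + 1 - i) - dd (n - i)) * inSecond (dd (i + 1)))
      = (pairing (fun γ : ℤ => s ^ γ * q.eval (γ : ℝ)) (dd (n + 1 - i))
        - pairing (fun γ : ℤ => s ^ γ * q.eval (γ : ℝ)) (dd (n - i)))
          * ((1 + t) * r.eval 0) := by
    intro i hi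
    rw [pairing_inFirst_mul_inSecond (fun γ : ℤ => s ^ γ * q.eval (γ : ℝ))
      (fun γ : ℤ => t ^ γ * r.eval (γ : ℝ)), map_sub]
    -- If `deg r ≥ 2(i+1)`, then `deg q < 2(n-i)`, so both first-variable moments are exact and
    -- cancel. Either way the second factor may be replaced by its exact value, independent of `i`.
    by_cases hr : r.natDegree < 2 * (i + 1)
    · rw [pairing_dd ht hr]
    · rw [pairing_dd hs (by omega), pairing_dd hs (by omega), sub_self, zero_mul, zero_mul]
  rw [Finset.sum_congr rfl hterm, ← Finset.sum_mul,
    sum_range_reflect_sub (fun m => pairing (fun γ : ℤ => s ^ γ * q.eval (γ : ℝ)) (dd m)),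
    pairing_dd hs (by omega), dd, map_zero]
  ring

/-! ### Derivatives of symbols -/

lemma iteratedDeriv_sum_zpow {ι : Type*} (S : Finset ι) (c : ι → ℂ) (m : ι → ℤ) (k : ℕ) {z : ℂ}
    (hz : z ≠ 0) :
    iteratedDeriv k (fun x => ∑ i ∈ S, c i * x ^ m i) z
      = ∑ i ∈ S, c i * ((descPochhammer ℂ k).eval (m i : ℂ) * z ^ (m i - k)) := by
  have hsmooth : ∀ i ∈ S, ContDiffAt ℂ k (fun x : ℂ => c i * x ^ m i) z := fun i _ =>
    contDiffAt_const.mul (analyticAt_id.fun_zpow hz).contDiffAt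
  rw [iteratedDeriv_fun_sum hsmooth]
  refine Finset.sum_congr rfl fun i _ => ?_
  rw [iteratedDeriv_const_mul_field, iteratedDeriv_eq_iterate, iter_deriv_zpow,
    descPochhammer_eval_eq_prod_range]

/-- Differentiating `z^α` produces falling factorials, so derivatives at `(±1, ±1)` are moments
against `descPochhammer` polynomials, up to a nonzero factor. -/
lemma partialDeriv_eq (k : ℕ × ℕ) (a : Symbol) {s t : ℝ} (hs : s ≠ 0) (ht : t ≠ 0) :
    partialDeriv k a s t = (((s ^ k.1)⁻¹ * (t ^ k.2)⁻¹ *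
      pairing (fun α : ℤ × ℤ => (s ^ α.1 * (descPochhammer ℝ k.1).eval (α.1 : ℝ)) *
        (t ^ α.2 * (descPochhammer ℝ k.2).eval (α.2 : ℝ))) a : ℝ) : ℂ) := by
  have hs' : (s : ℂ) ≠ 0 := by exact_mod_cast hs
  have ht' : (t : ℂ) ≠ 0 := by exact_mod_cast ht
  have hinner : (fun x : ℂ => iteratedDeriv k.2 (fun y => evalAt a x y) t)
      = fun x : ℂ => ∑ α ∈ a.coeff.support, ((a.coeff α : ℂ) *
        ((descPochhammer ℂ k.2).eval (α.2 : ℂ) * (t : ℂ) ^ (α.2 - k.2))) * x ^ α.1 := by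
    funext x
    simp only [evalAt]
    rw [iteratedDeriv_sum_zpow _ _ _ _ ht']
    exact Finset.sum_congr rfl fun α _ => by ring
  rw [partialDeriv, hinner, iteratedDeriv_sum_zpow _ _ _ _ hs', pairing_apply, Finset.mul_sum,
    Complex.ofReal_sum]
  refine Finset.sum_congr rfl fun α _ => ?_
  simp only [descPochhammer_eval_eq_prod_range, zpow_sub₀ hs', zpow_sub₀ ht', zpow_natCast]
  push_cast
  field_simp

lemma partialDeriv_eq_zero_iff (k : ℕ × ℕ) (a : Symbol) {s t : ℝ} (hs : s ≠ 0) (ht : t ≠ 0) :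
    partialDeriv k a s t = 0 ↔
      pairing (fun α : ℤ × ℤ => (s ^ α.1 * (descPochhammer ℝ k.1).eval (α.1 : ℝ)) *
        (t ^ α.2 * (descPochhammer ℝ k.2).eval (α.2 : ℝ))) a = 0 := by
  rw [partialDeriv_eq k a hs ht, Complex.ofReal_eq_zero, mul_eq_zero, or_iff_right]
  positivity

lemma evalAt_one_one (a : Symbol) : evalAt a 1 1 = (pairing (fun _ => 1) a : ℝ) := by
  simp [evalAt, pairing_apply]

lemma descPochhammer_natDegree_real (k : ℕ) : (descPochhammer ℝ k).natDegree = k :=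
  descPochhammer_natDegree ℝ k

lemma descPochhammer_eval_zero_real {k : ℕ} (hk : k ≠ 0) : (descPochhammer ℝ k).eval 0 = 0 := by
  rw [descPochhammer_eval_eq_prod_range]
  exact Finset.prod_eq_zero (Finset.mem_range.2 (Nat.pos_of_ne_zero hk)) (by simp)

lemma HasMoments.generates {a : Symbol} {d : ℕ} (h : HasMoments a d) : Generates a d := by
  intro k hk
  have key : ∀ s t : ℝ, (s = 1 ∨ s = -1) → (t = 1 ∨ t = -1) → (1 + s) * (1 + t) = 0 →
      partialDeriv k a s t = 0 := by
    intro s t hs ht h0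
    have hs0 : s ≠ 0 := by rcases hs with rfl | rfl <;> norm_num
    have ht0 : t ≠ 0 := by rcases ht with rfl | rfl <;> norm_num
    rw [partialDeriv_eq_zero_iff k a hs0 ht0, h s t hs ht _ _
      (by rwa [descPochhammer_natDegree_real, descPochhammer_natDegree_real]), h0, zero_mul]
  refine ⟨?_, ?_, ?_⟩
  · simpa using key (-1) 1 (by simp) (by simp) (by norm_num)
  · simpa using key 1 (-1) (by simp) (by simp) (by norm_num)
  · simpa using key (-1) (-1) (by simp) (by simp) (by norm_num)

lemma HasMoments.reproduces {a : Symbol} {d : ℕ} (h : HasMoments a d) : Reproduces a d := by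
  constructor
  · have := h 1 1 (by simp) (by simp) 1 1 (by simp)
    rw [evalAt_one_one]
    simp only [one_zpow, Polynomial.eval_one, mul_one] at this
    rw [this]
    norm_num
  · intro k hk hkd
    have h0 := (partialDeriv_eq_zero_iff k a (s := 1) (t := 1) one_ne_zero one_ne_zero).2 <| by
      rw [h 1 1 (by simp) (by simp) _ _
        (by rwa [descPochhammer_natDegree_real, descPochhammer_natDegree_real])]
      by_cases h1 : k.1 = 0
      · rw [descPochhammer_eval_zero_real (k := k.2) (by omega), mul_zero, mul_zero]
      · rw [descPochhammer_eval_zero_real h1, zero_mul, mul_zero]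
    simpa using h0

/-! ### Exact reproduction of polynomial samples -/

/-- Substitute `γ = α - 2β`: the sum over `β` runs over one coset of `2ℤ²`, encoded by parity. -/
lemma subdiv_eq_pairing (a : Symbol) (F : ℝ → ℝ → ℝ) (α : ℤ × ℤ) :
    subdiv a (fun β => F β.1 β.2) α
      = pairing (fun γ : ℤ × ℤ => if Even (α.1 - γ.1) ∧ Even (α.2 - γ.2)
          then F (((α.1 : ℝ) - γ.1) / 2) (((α.2 : ℝ) - γ.2) / 2) else 0) a := by
  set W : ℤ × ℤ → ℝ := fun γ => if Even (α.1 - γ.1) ∧ Even (α.2 - γ.2)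
          then F (((α.1 : ℝ) - γ.1) / 2) (((α.2 : ℝ) - γ.2) / 2) else 0 with hW
  let g : ℤ × ℤ → ℤ × ℤ := fun β => (α.1 - 2 * β.1, α.2 - 2 * β.2)
  have hg : Function.Injective g := by
    intro β β' h
    simp only [g, Prod.mk.injEq] at h
    exact Prod.ext (by omega) (by omega)
  have h1 : pairing W a = ∑ᶠ γ, a.coeff γ * W γ := by
    rw [pairing_apply, finsum_eq_sum_of_support_subset]
    intro γ hγ
    exact Finsupp.mem_support_iff.2 (left_ne_zero_of_mul hγ)
  have h2 : ∑ᶠ γ, a.coeff γ * W γ = ∑ᶠ γ ∈ Set.range g, a.coeff γ * W γ := by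
    refine finsum_congr fun γ => ?_
    by_cases hγ : γ ∈ Set.range g
    · simp [hγ]
    · simp only [hγ, finsum_false, hW]
      rw [if_neg, mul_zero]
      rintro ⟨⟨x, hx⟩, ⟨y, hy⟩⟩
      exact hγ ⟨(x, y), Prod.ext (by simp only [g]; omega) (by simp only [g]; omega)⟩
  rw [h1, h2, finsum_mem_range hg, subdiv]
  refine finsum_congr fun β => ?_
  simp only [g, hW, sub_sub_cancel, even_two_mul, and_self, if_true]
  push_cast
  rw [sub_sub_cancel, sub_sub_cancel, mul_div_cancel_left₀ _ two_ne_zero,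
    mul_div_cancel_left₀ _ two_ne_zero]

lemma even_and_even_indicator (x y : ℤ) (c : ℝ) :
    (if Even x ∧ Even y then c else 0)
      = 1 / 4 * ((1 + (-1) ^ x) * (1 + (-1) ^ y)) * c := by
  rcases Int.even_or_odd x with hx | hx <;> rcases Int.even_or_odd y with hy | hy
  · rw [if_pos ⟨hx, hy⟩, hx.neg_one_zpow, hy.neg_one_zpow]; ring
  · rw [if_neg fun h => Int.not_even_iff_odd.2 hy h.2, hy.neg_one_zpow]; ring
  · rw [if_neg fun h => Int.not_even_iff_odd.2 hx h.1, hx.neg_one_zpow]; ring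
  · rw [if_neg fun h => Int.not_even_iff_odd.2 hx h.1, hx.neg_one_zpow]; ring

/-- The indicator of a coset is a signed average of the four characters, of which only the trivial
one has nonzero moments. -/
lemma HasMoments.coset {a : Symbol} {d : ℕ} (h : HasMoments a d) (α : ℤ × ℤ)
    (q r : Polynomial ℝ) (hqr : q.natDegree + r.natDegree ≤ d) :
    pairing (fun γ : ℤ × ℤ => if Even (α.1 - γ.1) ∧ Even (α.2 - γ.2)
      then q.eval (γ.1 : ℝ) * r.eval (γ.2 : ℝ) else 0) a = q.eval 0 * r.eval 0 := by
  let w : ℝ → ℝ → ℤ × ℤ → ℝ := fun s t γ =>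
    (s ^ γ.1 * q.eval (γ.1 : ℝ)) * (t ^ γ.2 * r.eval (γ.2 : ℝ))
  have e : (fun γ : ℤ × ℤ => if Even (α.1 - γ.1) ∧ Even (α.2 - γ.2)
      then q.eval (γ.1 : ℝ) * r.eval (γ.2 : ℝ) else 0)
      = (1 / 4 : ℝ) • (w 1 1 + ((-1 : ℝ) ^ α.1) • w (-1) 1 + ((-1 : ℝ) ^ α.2) • w 1 (-1)
        + ((-1 : ℝ) ^ α.1 * (-1) ^ α.2) • w (-1) (-1)) := by
    have hsub : ∀ x y : ℤ, (-1 : ℝ) ^ (x - y) = (-1) ^ x * (-1) ^ y := fun x y => by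
      rw [sub_eq_add_neg, zpow_add₀ (by norm_num), zpow_neg, ← inv_zpow]
      norm_num
    funext γ
    rw [even_and_even_indicator, hsub, hsub]
    simp only [w, Pi.smul_apply, Pi.add_apply, smul_eq_mul, one_zpow]
    ring
  have hw : ∀ s t : ℝ, (s = 1 ∨ s = -1) → (t = 1 ∨ t = -1) →
      pairing (w s t) a = (1 + s) * (1 + t) * (q.eval 0 * r.eval 0) :=
    fun s t hs ht => h s t hs ht q r hqr
  rw [e]
  simp only [map_smul, map_add, LinearMap.smul_apply, LinearMap.add_apply, smul_eq_mul]
  rw [hw 1 1 (by simp) (by simp), hw (-1) 1 (by simp) (by simp), hw 1 (-1) (by simp) (by simp),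
    hw (-1) (-1) (by simp) (by simp)]
  ring

lemma HasMoments.subdiv_eval {a : Symbol} {d : ℕ} (h : HasMoments a d)
    (p : MvPolynomial (Fin 2) ℝ) (hp : p.totalDegree ≤ d) (c : ℝ) (α : ℤ × ℤ) :
    subdiv a (fun β => MvPolynomial.eval ![(β.1 : ℝ) / c, (β.2 : ℝ) / c] p) α
      = MvPolynomial.eval ![(α.1 : ℝ) / (2 * c), (α.2 : ℝ) / (2 * c)] p := by
  rw [subdiv_eq_pairing a (fun x y => MvPolynomial.eval ![x / c, y / c] p)]
  -- `L i` is the affine map `γ ↦ (i - γ)/(2c)`. Expanding `p` in monomials reduces to products of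
  -- powers of `L`, whose values at `0` reassemble `p(α/(2c))`.
  let L : ℤ → Polynomial ℝ := fun i =>
    Polynomial.C (2 * c)⁻¹ * (Polynomial.C (i : ℝ) - X)
  have hL : ∀ i, (L i).natDegree ≤ 1 := fun i =>
    (Polynomial.natDegree_C_mul_le _ _).trans (by compute_degree)
  have e : (fun γ : ℤ × ℤ => if Even (α.1 - γ.1) ∧ Even (α.2 - γ.2)
      then MvPolynomial.eval ![((α.1 : ℝ) - γ.1) / 2 / c, ((α.2 : ℝ) - γ.2) / 2 / c] p else 0)
      = ∑ m ∈ p.support, p.coeff m • fun γ : ℤ × ℤ =>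
        if Even (α.1 - γ.1) ∧ Even (α.2 - γ.2)
          then (L α.1 ^ m 0).eval (γ.1 : ℝ) * (L α.2 ^ m 1).eval (γ.2 : ℝ) else 0 := by
    funext γ
    simp only [Finset.sum_apply, Pi.smul_apply, smul_eq_mul]
    split_ifs
    · rw [MvPolynomial.eval_eq']
      refine Finset.sum_congr rfl fun m _ => ?_
      simp only [Fin.prod_univ_two, L, Polynomial.eval_pow, Polynomial.eval_mul,
        Polynomial.eval_C, Polynomial.eval_sub, Polynomial.eval_X, Matrix.cons_val_zero,
        Matrix.cons_val_one, div_div, inv_mul_eq_div]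
    · simp
  rw [e, map_sum, LinearMap.sum_apply, MvPolynomial.eval_eq']
  refine Finset.sum_congr rfl fun m hm => ?_
  have hdeg : (L α.1 ^ m 0).natDegree + (L α.2 ^ m 1).natDegree ≤ d := by
    have h1 := Polynomial.natDegree_pow_le_of_le (m 0) (hL α.1)
    have h2 := Polynomial.natDegree_pow_le_of_le (m 1) (hL α.2)
    have h3 := (MvPolynomial.le_totalDegree hm).trans hp
    rw [Finsupp.sum_fintype _ _ (fun _ => rfl), Fin.sum_univ_two] at h3
    omega
  rw [map_smul, LinearMap.smul_apply, h.coset α _ _ hdeg, smul_eq_mul]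
  simp only [Fin.prod_univ_two, L, Polynomial.eval_pow, Polynomial.eval_mul,
    Polynomial.eval_C, Polynomial.eval_sub, Polynomial.eval_X, Matrix.cons_val_zero,
    Matrix.cons_val_one, inv_mul_eq_div, sub_zero]

/-- The level-`k` data are exactly the samples of `p` on the grid `2^{-k} ℤ²`, so the error is zero
at every level. -/
lemma HasMoments.reproducesInLimit {a : Symbol} {d : ℕ} (h : HasMoments a d) :
    ReproducesInLimit a d := by
  intro p hp
  have key : ∀ k : ℕ, (subdiv a)^[k] (fun α => MvPolynomial.eval ![(α.1 : ℝ), (α.2 : ℝ)] p)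
      = fun α => MvPolynomial.eval ![(α.1 : ℝ) / 2 ^ k, (α.2 : ℝ) / 2 ^ k] p := by
    intro k
    induction k with
    | zero => simp
    | succ k ih =>
      rw [Function.iterate_succ_apply', ih]
      funext α
      rw [h.subdiv_eval p hp, pow_succ']
  intro R ε hε
  refine ⟨0, fun k _ α _ _ => ?_⟩
  rw [key, sub_self, abs_zero]
  exact hε

/-! ### Minimality of the support -/

/-- The falling factorials are monic, one in each degree, hence span; the induction removes leading
terms. -/
lemma linearMap_eq_zero_of_descPochhammer {d : ℕ} (φ : Polynomial ℝ →ₗ[ℝ] ℝ)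
    (hφ : ∀ k ≤ d, φ (descPochhammer ℝ k) = 0) (q : Polynomial ℝ) (hq : q.natDegree ≤ d) :
    φ q = 0 := by
  induction hn : q.natDegree using Nat.strong_induction_on generalizing q with
  | _ n ih =>
    subst hn
    set r := q - q.leadingCoeff • descPochhammer ℝ q.natDegree with hr
    have hq' : φ q = φ r := by
      rw [hr, map_sub, map_smul, hφ _ hq, smul_zero, sub_zero]
    rcases eq_or_ne q 0 with rfl | h0
    · exact map_zero φ
    rcases eq_or_ne r 0 with hr0 | hr0
    · rw [hq', hr0, map_zero]
    have hlt : r.degree < q.degree := by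
      have hlc : q.leadingCoeff ≠ 0 := Polynomial.leadingCoeff_ne_zero.2 h0
      have hm : (descPochhammer ℝ q.natDegree).leadingCoeff = 1 := monic_descPochhammer ℝ _
      refine Polynomial.degree_sub_lt_left ?_ h0 ?_
      · rw [Polynomial.smul_eq_C_mul, Polynomial.degree_C_mul hlc,
          Polynomial.degree_eq_natDegree h0,
          Polynomial.degree_eq_natDegree (monic_descPochhammer ℝ _).ne_zero,
          descPochhammer_natDegree_real]
      · rw [Polynomial.smul_eq_C_mul, Polynomial.leadingCoeff_mul, hm, mul_one,
          Polynomial.leadingCoeff_C]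
    have hlt' := Polynomial.natDegree_lt_natDegree hr0 hlt
    rw [hq']
    exact ih _ hlt' r (hlt'.le.trans hq) rfl

/-- The functional `q ↦ ∑_α a_α s^α₁ t^α₂ q(α₁)`. -/
def firstMoment (a : Symbol) (s t : ℝ) : Polynomial ℝ →ₗ[ℝ] ℝ where
  toFun q := pairing (fun α : ℤ × ℤ => (s ^ α.1 * q.eval (α.1 : ℝ)) * t ^ α.2) a
  map_add' q r := by
    rw [← LinearMap.add_apply, ← map_add]
    congr 2
    funext α
    simp only [Polynomial.eval_add, Pi.add_apply]
    ring
  map_smul' c q := by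
    rw [RingHom.id_apply, ← LinearMap.smul_apply, ← map_smul]
    congr 2
    funext α
    simp only [Polynomial.eval_smul, Pi.smul_apply, smul_eq_mul]
    ring

lemma firstMoment_descPochhammer (a : Symbol) {s t : ℝ} (hs : s ≠ 0) (ht : t ≠ 0) (k : ℕ) :
    firstMoment a s t (descPochhammer ℝ k) = 0 ↔ partialDeriv (k, 0) a s t = 0 := by
  rw [partialDeriv_eq_zero_iff _ _ hs ht]
  simp [firstMoment]

lemma Generates.firstMoment_eq_zero {a : Symbol} {d : ℕ} (h : Generates a d)
    {q : Polynomial ℝ} (hq : q.natDegree ≤ d) :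
    firstMoment a (-1) 1 q = 0 ∧ firstMoment a 1 (-1) q = 0 ∧ firstMoment a (-1) (-1) q = 0 := by
  refine ⟨linearMap_eq_zero_of_descPochhammer _ (fun k hk => ?_) q hq,
    linearMap_eq_zero_of_descPochhammer _ (fun k hk => ?_) q hq,
    linearMap_eq_zero_of_descPochhammer _ (fun k hk => ?_) q hq⟩ <;>
  rw [firstMoment_descPochhammer _ (by norm_num) (by norm_num)]
  · simpa using (h (k, 0) hk).1
  · simpa using (h (k, 0) hk).2.1
  · simpa using (h (k, 0) hk).2.2

lemma Generates.pairing_even_even {a : Symbol} {d : ℕ} (h : Generates a d)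
    {q : Polynomial ℝ} (hq : q.natDegree ≤ d) :
    pairing (fun α : ℤ × ℤ => if Even α.1 ∧ Even α.2 then q.eval (α.1 : ℝ) else 0) a
      = 1 / 4 * firstMoment a 1 1 q := by
  obtain ⟨h1, h2, h3⟩ := h.firstMoment_eq_zero hq
  have e : pairing (fun α : ℤ × ℤ => if Even α.1 ∧ Even α.2 then q.eval (α.1 : ℝ) else 0) a
      = (1 / 4 : ℝ) * (firstMoment a 1 1 q + firstMoment a (-1) 1 q + firstMoment a 1 (-1) q
        + firstMoment a (-1) (-1) q) := by
    simp only [firstMoment, LinearMap.coe_mk, AddHom.coe_mk, ← LinearMap.add_apply, ← map_add]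
    rw [← smul_eq_mul, ← LinearMap.smul_apply, ← map_smul]
    congr 2
    funext α
    rw [even_and_even_indicator]
    simp only [Pi.smul_apply, Pi.add_apply, smul_eq_mul, one_zpow]
    ring
  rw [e, h1, h2, h3]
  ring

/-- The sum rules annihilate the three nontrivial characters, so this coset carries a quarter of the
full moment, just as the even-even one does. -/
lemma Generates.pairing_odd_odd {a : Symbol} {d : ℕ} (h : Generates a d)
    {q : Polynomial ℝ} (hq : q.natDegree ≤ d) :
    pairing (fun α : ℤ × ℤ => if Odd α.1 ∧ Odd α.2 then q.eval (α.1 : ℝ) else 0) a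
      = 1 / 4 * firstMoment a 1 1 q := by
  obtain ⟨h1, h2, h3⟩ := h.firstMoment_eq_zero hq
  have e : pairing (fun α : ℤ × ℤ => if Odd α.1 ∧ Odd α.2 then q.eval (α.1 : ℝ) else 0) a
      = (1 / 4 : ℝ) * (firstMoment a 1 1 q - firstMoment a (-1) 1 q - firstMoment a 1 (-1) q
        + firstMoment a (-1) (-1) q) := by
    simp only [firstMoment, LinearMap.coe_mk, AddHom.coe_mk, ← LinearMap.add_apply, ← map_add,
      ← LinearMap.sub_apply, ← map_sub]
    rw [← smul_eq_mul, ← LinearMap.smul_apply, ← map_smul]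
    congr 2
    funext α
    have : (if Odd α.1 ∧ Odd α.2 then q.eval (α.1 : ℝ) else 0)
        = if Even (α.1 + 1) ∧ Even (α.2 + 1) then q.eval (α.1 : ℝ) else 0 := by
      simp only [Int.even_add_one, Int.not_even_iff_odd]
    rw [this, even_and_even_indicator, zpow_add_one₀ (by norm_num), zpow_add_one₀ (by norm_num)]
    simp only [Pi.smul_apply, Pi.add_apply, Pi.sub_apply, smul_eq_mul, one_zpow]
    ring
  rw [e, h1, h2, h3]
  ring

/-- The even-even coset of an interpolatory mask holds a single coefficient, `1` at the origin, and
it determines the full moment. -/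
lemma Generates.firstMoment_of_isInterpolatory {a : Symbol} {d : ℕ} (h : Generates a d)
    (ha : IsInterpolatory a) {q : Polynomial ℝ} (hq : q.natDegree ≤ d) :
    firstMoment a 1 1 q = 4 * q.eval 0 := by
  have h1 := h.pairing_even_even hq
  have h2 : pairing (fun α : ℤ × ℤ => if Even α.1 ∧ Even α.2 then q.eval (α.1 : ℝ) else 0) a
      = q.eval 0 := by
    have h00 : a.coeff (0, 0) = 1 := by simpa using ha 0 0
    rw [pairing_apply, Finset.sum_eq_single (0, 0)]
    · simp [h00]
    · rintro ⟨x, y⟩ _ hne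
      dsimp only
      split_ifs with he
      · obtain ⟨β₁, rfl⟩ := he.1.two_dvd
        obtain ⟨β₂, rfl⟩ := he.2.two_dvd
        rw [ha, if_neg, zero_mul]
        rintro ⟨rfl, rfl⟩
        exact hne rfl
      · rw [mul_zero]
    · intro h0
      exact absurd (Finsupp.notMem_support_iff.1 h0) (by rw [h00]; exact one_ne_zero)
  rw [h2] at h1
  linarith

lemma Reproduces.firstMoment_eq {a : Symbol} {d : ℕ} (h : Reproduces a d) {q : Polynomial ℝ}
    (hq : q.natDegree ≤ d) : firstMoment a 1 1 q = 4 * q.eval 0 := by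
  have := linearMap_eq_zero_of_descPochhammer (d := d)
    (firstMoment a 1 1 - (4 : ℝ) • Polynomial.leval 0) (fun k hk => ?_) q hq
  · simpa [sub_eq_zero] using this
  · rcases Nat.eq_zero_or_pos k with rfl | hk0
    · have h4 := h.1
      rw [evalAt_one_one] at h4
      have h4' : pairing (fun _ : ℤ × ℤ => (1 : ℝ)) a = 4 := by exact_mod_cast h4
      simp [firstMoment, h4']
    · have h1 := (firstMoment_descPochhammer a (s := 1) (t := 1) one_ne_zero one_ne_zero k).2
        (by simpa using h.2 (k, 0) hk0 hk)
      simp [h1, descPochhammer_eval_zero_real hk0.ne']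

lemma Generates.exists_coeff_ne_zero {a : Symbol} {n : ℕ} (h : Generates a (2 * n + 1))
    (hm : ∀ q : Polynomial ℝ, q.natDegree ≤ 2 * n + 1 → firstMoment a 1 1 q = 4 * q.eval 0) :
    ∃ α : ℤ × ℤ, a.coeff α ≠ 0 ∧ 2 * n + 1 ≤ |α.1| ∧ 1 ≤ |α.2| := by
  -- The roots of `q` are the odd integers of absolute value at most `2n - 1`, and `q(0) ≠ 0`. The
  -- odd-odd moment equals `q(0)`, so some coefficient lies beyond these roots; its `α₂` is odd,
  -- hence nonzero.
  set q : Polynomial ℝ :=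
    ∏ j ∈ Finset.range n, (X ^ 2 - Polynomial.C ((2 * (j : ℝ) + 1) ^ 2)) with hq
  have hdeg : q.natDegree ≤ 2 * n + 1 := by
    have h1 := Polynomial.natDegree_prod_le (Finset.range n)
      (fun j : ℕ => (X ^ 2 - Polynomial.C ((2 * (j : ℝ) + 1) ^ 2) : Polynomial ℝ))
    simp only [Polynomial.natDegree_X_pow_sub_C, Finset.sum_const, Finset.card_range,
      smul_eq_mul, ← hq] at h1
    omega
  have h0 : q.eval 0 ≠ 0 := by
    rw [hq, Polynomial.eval_prod, Finset.prod_ne_zero_iff]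
    intro j _
    simp only [Polynomial.eval_sub, Polynomial.eval_pow, Polynomial.eval_X, Polynomial.eval_C]
    have : (0 : ℝ) < (2 * (j : ℝ) + 1) ^ 2 := by positivity
    linarith
  have hodd := h.pairing_odd_odd hdeg
  rw [hm q hdeg, ← mul_assoc, one_div, inv_mul_cancel₀ four_ne_zero, one_mul] at hodd
  rw [← hodd, pairing_apply] at h0
  obtain ⟨α, -, hα⟩ := Finset.exists_ne_zero_of_sum_ne_zero h0
  have hw := right_ne_zero_of_mul hα
  split_ifs at hw with ho
  swap
  · exact absurd rfl hw
  refine ⟨α, left_ne_zero_of_mul hα, ?_, Int.one_le_abs ?_⟩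
  · by_contra hlt
    apply hw
    have ho' : Odd |α.1| := odd_abs.2 ho.1
    obtain ⟨j, hj⟩ := ho'
    have hj0 := abs_nonneg α.1
    obtain ⟨i, rfl⟩ := Int.eq_ofNat_of_zero_le (a := j) (by omega)
    rw [hq, Polynomial.eval_prod]
    refine Finset.prod_eq_zero (i := i) (Finset.mem_range.2 (by omega)) ?_
    simp only [Polynomial.eval_sub, Polynomial.eval_pow, Polynomial.eval_X, Polynomial.eval_C]
    have : |(α.1 : ℝ)| = 2 * i + 1 := by exact_mod_cast hj
    rw [← sq_abs, this, sub_self]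
  · rintro h0
    have := ho.2
    rw [h0] at this
    exact absurd this (by decide)

/-! ### Convex sets with the symmetries of the square. -/

lemma mem_of_abs_le {K : Set (ℝ × ℝ)} (hK : Convex ℝ K)
    (h₁ : ∀ x y, (x, y) ∈ K → (-x, y) ∈ K) (h₂ : ∀ x y, (x, y) ∈ K → (x, -y) ∈ K)
    {u v x y : ℝ} (huv : (u, v) ∈ K) (hx : |x| ≤ |u|) (hy : |y| ≤ |v|) : (x, y) ∈ K := by
  have hu : (|u|, v) ∈ K := by
    rcases abs_choice u with h | h <;> rw [h]
    · exact huv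
    · exact h₁ _ _ huv
  have huv' : (|u|, |v|) ∈ K := by
    rcases abs_choice v with h | h <;> rw [h]
    · exact hu
    · exact h₂ _ _ hu
  have hseg₁ : ∀ y', Convex ℝ {x' : ℝ | (x', y') ∈ K} := fun y' x₁ hx₁ x₂ hx₂ s t hs ht hst => by
    have := hK hx₁ hx₂ hs ht hst
    simpa [← add_mul, hst] using this
  have hseg₂ : ∀ x', Convex ℝ {y' : ℝ | (x', y') ∈ K} := fun x' y₁ hy₁ y₂ hy₂ s t hs ht hst => by
    have := hK hy₁ hy₂ hs ht hst
    simpa [← add_mul, hst] using this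
  have hxv : (x, |v|) ∈ K :=
    (hseg₁ |v|).ordConnected.out (h₁ _ _ huv') huv' (abs_le.1 hx)
  exact (hseg₂ x).ordConnected.out (h₂ _ _ hxv) hxv (abs_le.1 hy)

lemma octagon_subset {K : Set (ℝ × ℝ)} (hK : Convex ℝ K)
    (h₁ : ∀ x y, (x, y) ∈ K → (-x, y) ∈ K) (h₂ : ∀ x y, (x, y) ∈ K → (x, -y) ∈ K)
    (h₃ : ∀ x y, (x, y) ∈ K → (y, x) ∈ K) {m : ℝ} (hm : 1 ≤ m) (hm1 : (m, 1) ∈ K) :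
    octagon m m (m - 1) ⊆ K := by
  rintro ⟨x, y⟩ ⟨hx, hy, hxy⟩
  dsimp only at hx hy hxy
  have hseg : Convex ℝ {t : ℝ | (t, m + 1 - t) ∈ K} := fun t₁ ht₁ t₂ ht₂ c d hc hd hcd => by
    have := hK ht₁ ht₂ hc hd hcd
    simp only [Prod.smul_mk, Prod.mk_add_mk, smul_eq_mul] at this
    rw [Set.mem_ofPred_eq, smul_eq_mul, smul_eq_mul]
    convert this using 2
    linear_combination -(m + 1) * hcd
  -- This point lies on the segment from `(1, m)` to `(m, 1)`, an oblique edge of the octagon, and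
  -- dominates `(|x|, |y|)` in both coordinates.
  have ht : (max |x| 1, m + 1 - max |x| 1) ∈ K := by
    refine hseg.ordConnected.out (x := 1) (y := m) ?_ ?_ ⟨le_max_right _ _, max_le hx hm⟩
    · simpa using h₃ _ _ hm1
    · simpa using hm1
  refine mem_of_abs_le hK h₁ h₂ ht ?_ ?_
  · exact (le_max_left _ _).trans (le_abs_self _)
  · refine le_trans ?_ (le_abs_self _)
    rcases max_choice |x| 1 with h | h <;> rw [h] <;> linarith

lemma image_mem_supp {a : Symbol} (φ : ℝ × ℝ →ₗ[ℝ] ℝ × ℝ) (ψ : ℤ × ℤ → ℤ × ℤ)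
    (hφ : ∀ α : ℤ × ℤ, φ (α.1, α.2) = (((ψ α).1 : ℝ), ((ψ α).2 : ℝ)))
    (hψ : ∀ α, a.coeff (ψ α) = a.coeff α) {x : ℝ × ℝ} (hx : x ∈ supp a) : φ x ∈ supp a := by
  have h : φ '' supp a ⊆ supp a := by
    rw [supp, φ.image_convexHull]
    refine convexHull_mono ?_
    rintro _ ⟨_, ⟨α, hα, rfl⟩, rfl⟩
    exact ⟨ψ α, by rw [Set.mem_ofPred_eq, hψ]; exact hα, (hφ α).symm⟩
  exact h ⟨x, hx, rfl⟩

lemma IsSymmetric.octagon_subset_supp {a : Symbol} (ha : IsSymmetric a) {n : ℕ} {α : ℤ × ℤ}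
    (hα : a.coeff α ≠ 0) (h1 : 2 * n + 1 ≤ |α.1|) (h2 : 1 ≤ |α.2|) :
    octagon (2 * n + 1) (2 * n + 1) (2 * n) ⊆ supp a := by
  have hK : Convex ℝ (supp a) := convex_convexHull ℝ _
  have hs₁ : ∀ x y, (x, y) ∈ supp a → (-x, y) ∈ supp a := fun x y h => by
    simpa using image_mem_supp ((-LinearMap.id).prodMap LinearMap.id) (fun α => (-α.1, α.2))
      (fun α => by simp) (fun α => (ha α.1 α.2).1.symm) h
  have hs₂ : ∀ x y, (x, y) ∈ supp a → (x, -y) ∈ supp a := fun x y h => by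
    simpa using image_mem_supp (LinearMap.id.prodMap (-LinearMap.id)) (fun α => (α.1, -α.2))
      (fun α => by simp) (fun α => (ha α.1 α.2).2.1.symm) h
  have hs₃ : ∀ x y, (x, y) ∈ supp a → (y, x) ∈ supp a := fun x y h => by
    simpa using image_mem_supp (LinearEquiv.prodComm ℝ ℝ ℝ).toLinearMap (fun α => (α.2, α.1))
      (fun α => by simp) (fun α => (ha α.1 α.2).2.2.symm) h
  have hmem : ((α.1 : ℝ), (α.2 : ℝ)) ∈ supp a := subset_convexHull ℝ _ ⟨α, hα, rfl⟩
  have h1' : (2 * n + 1 : ℝ) ≤ |(α.1 : ℝ)| := by exact_mod_cast h1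
  have h2' : (1 : ℝ) ≤ |(α.2 : ℝ)| := by exact_mod_cast h2
  have hm : ((2 * n + 1 : ℝ), (1 : ℝ)) ∈ supp a :=
    mem_of_abs_le hK hs₁ hs₂ hmem
      (by rwa [abs_of_nonneg (by positivity : (0 : ℝ) ≤ 2 * n + 1)]) (by rwa [abs_one])
  have := octagon_subset hK hs₁ hs₂ hs₃
    (by linarith [Nat.cast_nonneg (α := ℝ) n] : (1 : ℝ) ≤ 2 * n + 1) hm
  rwa [add_sub_cancel_right] at this

lemma convex_octagon (m n l : ℝ) : Convex ℝ (octagon m n l) := by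
  have h1 : ConvexOn ℝ Set.univ fun x : ℝ × ℝ => |x.1| :=
    (convexOn_norm convex_univ).comp_linearMap (LinearMap.fst ℝ ℝ ℝ)
  have h2 : ConvexOn ℝ Set.univ fun x : ℝ × ℝ => |x.2| :=
    (convexOn_norm convex_univ).comp_linearMap (LinearMap.snd ℝ ℝ ℝ)
  have := ((h1.convex_le m).inter (h2.convex_le n)).inter ((h1.add h2).convex_le (m + n - l))
  convert this using 1
  ext x
  simp [octagon, and_assoc]

lemma supp_hatA_subset (n : ℕ) :
    supp (hatA (n + 1)) ⊆ octagon (2 * n + 1) (2 * n + 1) (2 * n) := by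
  refine convexHull_min ?_ (convex_octagon _ _ _)
  rintro _ ⟨α, hα, rfl⟩
  obtain ⟨h1, h2, h3⟩ := hatA_coeff_ne_zero hα
  have h1' : |(α.1 : ℝ)| ≤ 2 * n + 1 := by exact_mod_cast h1
  have h2' : |(α.2 : ℝ)| ≤ 2 * n + 1 := by exact_mod_cast h2
  refine ⟨h1', h2', ?_⟩
  have h3' : |(α.1 : ℝ)| + |(α.2 : ℝ)| ≤ 2 * n + 2 := by exact_mod_cast h3
  dsimp only
  linarith

/-- The octagon lies between the two supports, so the comparison of areas is an inclusion of sets.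
-/
lemma suppSize_hatA_le {a : Symbol} {n : ℕ} (ha : IsSymmetric a) (h : Generates a (2 * n + 1))
    (hm : ∀ q : Polynomial ℝ, q.natDegree ≤ 2 * n + 1 → firstMoment a 1 1 q = 4 * q.eval 0) :
    suppSize (hatA (n + 1)) ≤ suppSize a := by
  obtain ⟨α, h0, h1, h2⟩ := h.exists_coeff_ne_zero hm
  exact MeasureTheory.measure_mono
    ((supp_hatA_subset n).trans (ha.octagon_subset_supp h0 h1 h2))

end PseudoSpline

end

theorem mainTheorem3 (n : ℕ) (hn : 1 ≤ n) :
    PseudoSpline.IsInterpolatory (PseudoSpline.hatA n) ∧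
    PseudoSpline.IsSymmetric (PseudoSpline.hatA n) ∧
    PseudoSpline.Generates (PseudoSpline.hatA n) (2 * n - 1) ∧
    PseudoSpline.Reproduces (PseudoSpline.hatA n) (2 * n - 1) ∧
    PseudoSpline.GeneratesInLimit (PseudoSpline.hatA n) (2 * n - 1) ∧
    PseudoSpline.ReproducesInLimit (PseudoSpline.hatA n) (2 * n - 1) ∧
    PseudoSpline.supp (PseudoSpline.hatA n)
      = PseudoSpline.octagon (2 * n - 1) (2 * n - 1) (2 * n - 2) ∧
    (∀ a : PseudoSpline.Symbol, PseudoSpline.IsSymmetric a → PseudoSpline.IsInterpolatory a →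
      PseudoSpline.Generates a (2 * n - 1) →
        PseudoSpline.suppSize (PseudoSpline.hatA n) ≤ PseudoSpline.suppSize a) ∧
    (∀ a : PseudoSpline.Symbol, PseudoSpline.IsSymmetric a →
      PseudoSpline.Generates a (2 * n - 1) → PseudoSpline.Reproduces a (2 * n - 1) →
        PseudoSpline.suppSize (PseudoSpline.hatA n) ≤ PseudoSpline.suppSize a) := by
  obtain ⟨m, rfl⟩ : ∃ m, n = m + 1 := ⟨n - 1, by omega⟩
  rw [show 2 * (m + 1) - 1 = 2 * m + 1 by omega,
    show (2 * ((m + 1 : ℕ) : ℝ) - 1) = 2 * m + 1 by push_cast; ring,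
    show (2 * ((m + 1 : ℕ) : ℝ) - 2) = 2 * m by push_cast; ring]
  have hmom := PseudoSpline.hasMoments_hatA m
  have hint := PseudoSpline.isInterpolatory_hatA m
  have hsym := PseudoSpline.isSymmetric_hatA m
  refine ⟨hint, hsym, hmom.generates, hmom.reproduces,
    fun p hp => ⟨_, hmom.reproducesInLimit p hp⟩, hmom.reproducesInLimit, ?_, ?_, ?_⟩
  -- The lower bound for competing symbols, applied to `hatA` itself, shows that its support fills
  -- the octagon.
  · obtain ⟨α, h0, h1, h2⟩ := hmom.generates.exists_coeff_ne_zero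
      fun q hq => hmom.reproduces.firstMoment_eq hq
    exact (PseudoSpline.supp_hatA_subset m).antisymm (hsym.octagon_subset_supp h0 h1 h2)
  · exact fun a ha hi hg => PseudoSpline.suppSize_hatA_le ha hg
      fun q hq => hg.firstMoment_of_isInterpolatory hi hq
  · exact fun a ha hg hr => PseudoSpline.suppSize_hatA_le ha hg
      fun q hq => hr.firstMoment_eq hq
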